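/- **Setting.** Let $H$ be a real Hilbert space and $T:H\to 2^H$ a maximal monotone operator, i.e. $\langle x-x',y-y'\rangle\ge 0$ whenever $y\in T(x)$, $y'\in T(x')$, and the graph of $T$ is not properly contained in the graph of another monotone operator. Let $S=\{x\in H: 0\in T(x)\}$ and, for $r>0$, let $\mathsf J_r=(I+rT)^{-1}:H\to H$ be the resolvent. Let $u,z_0\in H$, $(e_n)\subset H$, $c_n>0$, $\lambda_n,\gamma_n,\delta_n\in(0,1)$ with $\lambda_n+\gamma_n+\delta_n=1$, and $$z_{n+1}=\lambda_n u+\gamma_n z_n+\delta_n\mathsf J_{c_n}(z_n)+e_n\qquad(n\in\mathbb N).$$ Here $0\in\mathbb N$, and intervals $[n,m]$ of indices are intervals in $\mathbb N$. **Monotonicity.** For $f,g:\mathbb N\to\mathbb N$ write $g\le^* f$ if $g(m)\le f(n)$ and $f(m)\le f(n)$ for all $m\le n$. A functional $\varphi:\mathbb N\times\mathbb N^{\mathbb N}\to\mathbb N$ is *monotone* if $\varphi(m,g)\le\varphi(n,f)$ for all $m\le n$ and all $f,g$ with $g\le^* f$. A function $f:\mathbb N\to\mathbb N$ is *monotone*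 if $f\le^*f$, equivalently if it is nondecreasing. **Hypotheses.** Let $a,c\in\mathbb N\setminus\{0\}$ and let $\ell,L,E:\mathbb N\to\mathbb N$ be monotone functions such that - $(Q_1)$ $\lambda_n\le\frac1{k+1}$ for all $k$ and all $n\ge\ell(k)$; - $(Q_2)$ $\sum_{i=1}^{L(k)}\lambda_i\ge k$ for all $k$; - $(Q_3)$ $\frac1a\le\gamma_m\le1-\frac1a$ for all $m$; - $(Q_4)$ $c_n\ge\frac1c$ for all $n$; - $(Q_6)$ $\sum_{i=E(k)+1}^{E(k)+n}\|e_i\|\le\frac1{k+1}$ for all $k,n$. Let $\mathcal C:\mathbb N\to\mathbb N$ be a monotone function with $c_n\le\mathcal C(n)$ for all $n$. Let $N_2,N_3\in\mathbb N$ be such that $N_2\ge\sum_{i=0}^{E(0)}\|e_i\|+1$ and, for some $s\in S$, $N_3\ge\max\{\|u-s\|,\|z_0-s\|\}$. Put $N:=\max\{2N_3,N_2+N_3\}$. Let $(w_n)\subset H$ be such that $z_{n+1}=\gamma_nz_n+(1-\gamma_n)w_n$ for all $n$, and let $\chi:\mathbb N\times\mathbb N^{\mathbb N}\to\mathbb N$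 be a monotone functional satisfying - $(Q_S)$ for all $k\in\mathbb N$ and all monotone $f:\mathbb N\to\mathbb N$ there is $n\le\chi(k,f)$ such that $\|w_m-z_m\|\le\frac1{k+1}$ for all $m\in[n,n+f(n)]$. **Conclusion.** For all $k\in\mathbb N$ and all monotone $f:\mathbb N\to\mathbb N$ there is $n\le\phi_\chi(k,f)$ such that $$\|z_i-z_j\|\le\frac1{k+1}\quad\text{for all } i,j\in[n,n+f(n)],$$ where $\phi_\chi(k,f):=\Theta\big(4(k+1)^2-1,\ m\mapsto m+f(m),\ L,\ \Psi_\chi,\ G,\ 4N^2\big)$ is built as follows, $F^{(r)}$ denoting the $r$-fold iterate of $F$: - $M_1:=3N_2+4N$, $M_2:=M_1+2(N_3+N)$, $G(k):=E(M_2(k+1))$; - $\Theta(k,f,L,\Psi,G,D):=L\big(h(\Psi(4k+3,g))\big)+1$, where $h(m):=\max\{m,G(4k+3)+1\}+\lceil\ln(4D(k+1))\rceil$ and $g(m):=4(k+1)\big(f(L(h(m))+1)+1\big)$; - $\mu(k):=\max\{\ell(4a(k+1)(N_2+2N_3)),\,E(4a(k+1))+1\}$ and $\xi_\chi(k,f):=\max\{\mu(2k+1),\chi(4a(k+1),\tilde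 f_{2k+1})\}$, where $\tilde f_k(m):=\mu(k)+f(\max\{\mu(k),m\})$; - $\psi_\chi(k,f):=\xi_\chi\big(24N(\check g^{(R)}(0)+1)^2,\,f+1\big)$, where $R:=N^4(k+1)^2$, $g(m):=f(\xi_\chi(m,f+1))$, $\check g(m):=\max\{g(24N(m+1)^2),\,24N(m+1)^2\}$ and $(f+1)(m):=f(m)+1$; - $\zeta(k,n):=\mathcal C(n)\,c\,(k+1)-1$ and $\Psi_\chi(k,f):=\psi_\chi(2k+1,h)$, where $h(m):=\zeta\big((1+4N)(f(m)+1)-1,\,f(m)\big)$. -/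

import Mathlib

namespace MPPA

/-! ### Monotone operators and their resolvents -/

section Operators

variable {H : Type*} [NormedAddCommGroup H] [InnerProductSpace ℝ H]

/-- A multi-valued operator on `H` is monotone. -/
def IsMonotoneOp (T : H → Set H) : Prop :=
  ∀ x x' y y' : H, y ∈ T x → y' ∈ T x' → 0 ≤ inner ℝ (x - x') (y - y')

/-- A monotone operator whose graph is not properly contained in the graph of another
monotone operator. -/
def IsMaximalMonotoneOp (T : H → Set H) : Prop :=
  IsMonotoneOp T ∧ ∀ T' : H → Set H, IsMonotoneOp T' → (∀ x, T x ⊆ T' x) → T' = T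

/-- The set of zeros of an operator. -/
def zeros (T : H → Set H) : Set H := {x | 0 ∈ T x}

/-- The resolvent `(I + c T)⁻¹`: the point `y` with `x ∈ y + c T y`. For `c > 0` and `T` monotone
there is at most one such point, see `resolventMap_eq`. -/
noncomputable def resolventMap (T : H → Set H) (c : ℝ) (x : H) : H :=
  Classical.epsilon fun y => ∃ v ∈ T y, y + c • v = x

/-- If `T` is monotone, `c > 0` and `x ∈ y + c T y`, then `resolventMap T c x` is `y`. -/
theorem resolventMap_eq {T : H → Set H} (hT : IsMonotoneOp T) {c : ℝ} (hc : 0 < c) {x y v : H}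
    (hv : v ∈ T y) (h : y + c • v = x) : resolventMap T c x = y := by
  obtain ⟨v', hv', h'⟩ := Classical.epsilon_spec
    (p := fun y => ∃ v ∈ T y, y + c • v = x) ⟨y, v, hv, h⟩
  change v' ∈ T (resolventMap T c x) at hv'
  change resolventMap T c x + c • v' = x at h'
  have h1 := hT _ _ _ _ hv' hv
  have h2 : resolventMap T c x - y = c • (v - v') := by
    have h3 : resolventMap T c x + c • v' = y + c • v := h'.trans h.symm
    rw [smul_sub, sub_eq_sub_iff_add_eq_add, h3, add_comm]
  have h4 : inner ℝ (v - v') (v' - v) = - ‖v - v'‖ ^ 2 := by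
    rw [← neg_sub v v', inner_neg_right, real_inner_self_eq_norm_sq]
  rw [h2, real_inner_smul_left, h4] at h1
  have h5 : ‖v - v'‖ ^ 2 = 0 := by
    have := sq_nonneg ‖v - v'‖
    nlinarith
  have h6 : v - v' = 0 := by simpa using h5
  rw [h6, smul_zero] at h2
  exact sub_eq_zero.mp h2

end Operators

/-! ### Strong majorizability -/

/-- `g ≤* f` for functions `ℕ → ℕ`. -/
def FunMaj (g f : ℕ → ℕ) : Prop :=
  ∀ n, ∀ m ≤ n, g m ≤ f n ∧ f m ≤ f n

/-- `φ ≤* ψ` for functionals `ℕ × ℕ^ℕ → ℕ`. -/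
def FunctionalMaj (φ ψ : ℕ → (ℕ → ℕ) → ℕ) : Prop :=
  ∀ (n : ℕ) (f : ℕ → ℕ), ∀ m ≤ n, ∀ g : ℕ → ℕ, FunMaj g f →
    φ m g ≤ ψ n f ∧ ψ m g ≤ ψ n f

/-- A functional is monotone if it majorizes itself. -/
def MonotoneFunctional (φ : ℕ → (ℕ → ℕ) → ℕ) : Prop := FunctionalMaj φ φ

/-- For functions, `f ≤* f` is the usual monotonicity. -/
theorem funMaj_self_iff (f : ℕ → ℕ) : FunMaj f f ↔ Monotone f :=
  ⟨fun h m n hmn => (h n m hmn).1, fun h _ _ hmn => ⟨h hmn, h hmn⟩⟩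

/-- `χ` is a rate of metastability for `‖w m - z m‖ → 0`. -/
def MetaNull {H : Type*} [NormedAddCommGroup H] (w z : ℕ → H) (χ : ℕ → (ℕ → ℕ) → ℕ) : Prop :=
  ∀ (k : ℕ) (f : ℕ → ℕ), Monotone f →
    ∃ n ≤ χ k f, ∀ m ∈ Set.Icc n (n + f n), ‖w m - z m‖ ≤ 1 / ((k : ℝ) + 1)

/-! ### The functionals making up the bound -/

/-- The function `μ`, with `N₀ = N₂ + N₃`. -/
def mu (a N₂ N₃ : ℕ) (ℓ E : ℕ → ℕ) (k : ℕ) : ℕ :=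
  max (ℓ (4 * a * (k + 1) * ((N₂ + N₃) + N₃))) (E (4 * a * (k + 1)) + 1)

/-- The functional `f̃ₖ`, with `μ` as a parameter. -/
def tildeFun (μ : ℕ → ℕ) (f : ℕ → ℕ) (k m : ℕ) : ℕ :=
  μ k + f (max (μ k) m)

/-- The functional `ξ_χ`. -/
def xi (χ : ℕ → (ℕ → ℕ) → ℕ) (μ : ℕ → ℕ) (a : ℕ) (k : ℕ) (f : ℕ → ℕ) : ℕ :=
  max (μ (2 * k + 1)) (χ (4 * a * (k + 1)) (tildeFun μ f (2 * k + 1)))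

/-- The function `ǧ` obtained from `g`. -/
def check (N : ℕ) (g : ℕ → ℕ) (m : ℕ) : ℕ :=
  max (g (24 * N * (m + 1) ^ 2)) (24 * N * (m + 1) ^ 2)

/-- The functional `ψ_χ`, with `ξ = ξ_χ` as a parameter. -/
def psi (ξ : ℕ → (ℕ → ℕ) → ℕ) (N : ℕ) (k : ℕ) (f : ℕ → ℕ) : ℕ :=
  ξ (24 * N *
      ((check N (fun m => f (ξ m (fun j => f j + 1))))^[N ^ 4 * (k + 1) ^ 2] 0 + 1) ^ 2)
    (fun j => f j + 1)

/-- The function `ζ`. -/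
def zeta (C : ℕ → ℕ) (c : ℕ) (k n : ℕ) : ℕ :=
  C n * c * (k + 1) - 1

/-- The functional `Ψ_χ`, with `ψ = ψ_χ` as a parameter. -/
def bigPsi (ψ : ℕ → (ℕ → ℕ) → ℕ) (C : ℕ → ℕ) (c N : ℕ) (k : ℕ) (f : ℕ → ℕ) : ℕ :=
  ψ (2 * k + 1) (fun m => zeta C c ((1 + 4 * N) * (f m + 1) - 1) (f m))

/-- The auxiliary function `h` in the definition of `Θ`. -/
noncomputable def thetaH (k : ℕ) (G : ℕ → ℕ) (D : ℕ) (m : ℕ) : ℕ :=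
  max m (G (4 * k + 3) + 1) + ⌈Real.log (4 * (D : ℝ) * ((k : ℝ) + 1))⌉₊

/-- The auxiliary function `g` in the definition of `Θ`. -/
noncomputable def thetaG (k : ℕ) (f L G : ℕ → ℕ) (D : ℕ) (m : ℕ) : ℕ :=
  4 * (k + 1) * (f (L (thetaH k G D m) + 1) + 1)

/-- The functional `Θ(k, f, L, Ψ, G, D)`. -/
noncomputable def Theta (k : ℕ) (f L : ℕ → ℕ) (Ψ : ℕ → (ℕ → ℕ) → ℕ) (G : ℕ → ℕ) (D : ℕ) : ℕ :=
  L (thetaH k G D (Ψ (4 * k + 3) (thetaG k f L G D))) + 1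

/-- `N = max {2 N₃, N₂ + N₃}`. -/
def boundN (N₂ N₃ : ℕ) : ℕ := max (2 * N₃) (N₂ + N₃)

/-- `M₁ = 3 N₂ + 4 N`. -/
def boundM₁ (N₂ N₃ : ℕ) : ℕ := 3 * N₂ + 4 * boundN N₂ N₃

/-- `M₂ = M₁ + 2 (N₃ + N)`. -/
def boundM₂ (N₂ N₃ : ℕ) : ℕ := boundM₁ N₂ N₃ + 2 * (N₃ + boundN N₂ N₃)

/-- `Ψ_χ = Ψ_χ[N₂, N₃, a, c, ℓ, E, C]`. -/
def PsiChi (χ : ℕ → (ℕ → ℕ) → ℕ) (a c N₂ N₃ : ℕ) (ℓ E C : ℕ → ℕ) : ℕ → (ℕ → ℕ) → ℕ :=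
  bigPsi (psi (xi χ (mu a N₂ N₃ ℓ E) a) (boundN N₂ N₃)) C c (boundN N₂ N₃)

/-- The bound `φ_χ(k, f)`. -/
noncomputable def phi (χ : ℕ → (ℕ → ℕ) → ℕ) (a c N₂ N₃ : ℕ) (ℓ L E C : ℕ → ℕ)
    (k : ℕ) (f : ℕ → ℕ) : ℕ :=
  Theta (4 * (k + 1) ^ 2 - 1) (fun m => m + f m) L
    (PsiChi χ a c N₂ N₃ ℓ E C)
    (fun j => E (boundM₂ N₂ N₃ * (j + 1)))
    (4 * boundN N₂ N₃ ^ 2)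

end MPPA

/-!
Strong convergence of the modified proximal point iteration rests on Xu's lemma: for `x` a point of
`S`, the numbers `‖z m - x‖²` satisfy
`s (m + 1) ≤ (1 - λ_m) s m + λ_m * 2 ⟪u - x, z (m + 1) - x⟫ + 4 N ‖e m‖`,
and with `x` the projection of `u` onto `S` the inner products become asymptotically nonpositive.
Here neither the projection nor weak compactness is used. Since only finitely many indices matter
at a time, it is enough to have an `x` that is nearly fixed by the resolvents at those indices and
nearly minimises the distance to `u`.

Such an `x` comes from a descent (`exists_almost_minimizer`): starting from a zero `s`, one passes
to approximate fixed points that are closer to `u` by a fixed amount in the squared distance but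
are fixed less accurately; this stops within `R = N⁴ (k + 1)²` steps. Where it stops, near
minimality on segments from `x` to approximate fixed points, which consist of approximate fixed
points again, gives the variational inequality `⟪u - x, z m - x⟫ ≤ 1 / (k + 1)` for those `m` at
which `z m` is nearly fixed (`exists_almost_projection`). A stretch of such `m` is provided by the
rate `χ` via `metaNull_xi`. One resolvent controls the others through
`norm_resolventMap_sub_self_compare`, giving `exists_almost_common_projection`.
The approximate form of the recursive inequality, with an extra error inside the factor
`1 - λ_m`, is `norm_resolvent_step_sub_sq_le`, and `le_one_div_of_recurrence` solves it: the
product of the `1 - λ_i` is at most `exp (- ∑ λ_i)`. This puts all `z i` of the stretch within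
`1 / (2 (k + 1))` of `x`.

That the resolvents are defined everywhere is Minty's theorem (`resolventMap_spec`). It is proved
by minimising the Fitzpatrick function plus half the squared norm on `H × H`.
-/

namespace MPPA

/-! ### Minty's theorem -/

/-- A closed convex subset of `E × ℝ` on which `(p, t) ↦ t + ‖p‖² / 2` is bounded below contains
a minimiser of that function: minimising sequences are Cauchy by the parallelogram law. -/
theorem exists_minimizer_add_half_norm_sq {E : Type*} [NormedAddCommGroup E]
    [InnerProductSpace ℝ E] [CompleteSpace E] {K : Set (E × ℝ)} (hK : IsClosed K)
    (hconv : Convex ℝ K) (hne : K.Nonempty)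
    (hbdd : ∀ p ∈ K, 0 ≤ p.2 + ‖p.1‖ ^ 2 / 2) :
    ∃ p ∈ K, ∀ q ∈ K, p.2 + ‖p.1‖ ^ 2 / 2 ≤ q.2 + ‖q.1‖ ^ 2 / 2 := by
  set φ : E × ℝ → ℝ := fun p => p.2 + ‖p.1‖ ^ 2 / 2 with hφ
  have hbb : BddBelow (φ '' K) := ⟨0, by rintro _ ⟨p, hp, rfl⟩; exact hbdd p hp⟩
  set m := sInf (φ '' K) with hm
  have hmle : ∀ p ∈ K, m ≤ φ p := fun p hp => csInf_le hbb ⟨p, hp, rfl⟩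
  have hseq : ∀ n : ℕ, ∃ p ∈ K, φ p < m + 1 / ((n : ℝ) + 1) := by
    intro n
    obtain ⟨_, ⟨p, hp, rfl⟩, h⟩ := exists_lt_of_csInf_lt (hne.image φ)
      (show sInf (φ '' K) < m + 1 / ((n : ℝ) + 1) by
        have : (0 : ℝ) < 1 / ((n : ℝ) + 1) := by positivity
        linarith)
    exact ⟨p, hp, h⟩
  choose p hpK hpm using hseq
  have key : ∀ i j, ‖(p i).1 - (p j).1‖ ^ 2 ≤ 4 * (1 / ((i : ℝ) + 1) + 1 / ((j : ℝ) + 1)) := by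
    intro i j
    have hmid := hmle _ (hconv (hpK i) (hpK j) (by norm_num : (0 : ℝ) ≤ 1 / 2)
      (by norm_num : (0 : ℝ) ≤ 1 / 2) (by norm_num))
    have h1 := hpm i
    have h2 := hpm j
    simp only [hφ, Prod.fst_add, Prod.smul_fst, Prod.snd_add, Prod.smul_snd, smul_eq_mul]
      at hmid h1 h2
    rw [← smul_add, norm_smul, mul_pow, Real.norm_eq_abs, sq_abs] at hmid
    have hpar := parallelogram_law_with_norm ℝ (p i).1 (p j).1
    nlinarith
  have hcau : CauchySeq fun n => (p n).1 := by
    refine cauchySeq_of_le_tendsto_0 (fun n : ℕ => √(8 * (1 / ((n : ℝ) + 1)))) ?_ ?_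
    · intro i j n hi hj
      rw [dist_eq_norm]
      refine Real.le_sqrt_of_sq_le ((key i j).trans ?_)
      have h1 : 1 / ((i : ℝ) + 1) ≤ 1 / ((n : ℝ) + 1) := Nat.one_div_le_one_div hi
      have h2 : 1 / ((j : ℝ) + 1) ≤ 1 / ((n : ℝ) + 1) := Nat.one_div_le_one_div hj
      linarith
    · have := (tendsto_one_div_add_atTop_nhds_zero_nat (𝕜 := ℝ)).const_mul 8
      have h := (Real.continuous_sqrt.tendsto _).comp this
      rwa [mul_zero, Real.sqrt_zero] at h
  obtain ⟨x, hx⟩ := cauchySeq_tendsto_of_complete hcau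
  have hφm : Filter.Tendsto (fun n => φ (p n)) Filter.atTop (nhds m) := by
    refine tendsto_of_tendsto_of_tendsto_of_le_of_le tendsto_const_nhds ?_
      (fun n => hmle _ (hpK n)) (fun n => (hpm n).le)
    simpa using (tendsto_one_div_add_atTop_nhds_zero_nat (𝕜 := ℝ)).const_add m
  have ht : Filter.Tendsto (fun n => (p n).2) Filter.atTop (nhds (m - ‖x‖ ^ 2 / 2)) := by
    have := hφm.sub ((hx.norm.pow 2).div_const 2)
    simpa [hφ] using this
  refine ⟨(x, m - ‖x‖ ^ 2 / 2),
    hK.mem_of_tendsto (hx.prodMk_nhds ht) (Filter.Eventually.of_forall hpK), fun q hq => ?_⟩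
  have := hmle q hq
  simp only [hφ] at this
  simpa using this

/-- First-order optimality: a minimiser `p` of `(p, t) ↦ t + ‖p‖² / 2` on a convex set has `-p`
as a subgradient there. -/
theorem sub_inner_le_of_minimizer {E : Type*} [NormedAddCommGroup E]
    [InnerProductSpace ℝ E] {K : Set (E × ℝ)} (hconv : Convex ℝ K) {p : E × ℝ} (hp : p ∈ K)
    (hmin : ∀ q ∈ K, p.2 + ‖p.1‖ ^ 2 / 2 ≤ q.2 + ‖q.1‖ ^ 2 / 2) {q : E × ℝ} (hq : q ∈ K) :
    p.2 - inner ℝ p.1 (q.1 - p.1) ≤ q.2 := by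
  by_contra! h
  set A := q.2 - p.2 + inner ℝ p.1 (q.1 - p.1) with hA
  set B := ‖q.1 - p.1‖ ^ 2 with hB
  have hA0 : A < 0 := by linarith
  have hB0 : 0 ≤ B := by positivity
  have hBA : 0 < B - A := by linarith
  set θ := -A / (B - A) with hθ
  have hθ0 : 0 < θ := div_pos (by linarith) hBA
  have hθ1 : θ ≤ 1 := (div_le_one hBA).2 (by linarith)
  have hθe : θ * (B - A) = -A := div_mul_cancel₀ _ hBA.ne'
  have h1 := hmin _ (hconv hp hq (by linarith : 0 ≤ 1 - θ) hθ0.le (by ring))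
  have h2 : ((1 - θ) • p + θ • q).1 = p.1 + θ • (q.1 - p.1) := by
    simp only [Prod.fst_add, Prod.smul_fst]; module
  rw [h2, norm_add_sq_real, norm_smul, mul_pow, Real.norm_eq_abs, sq_abs, inner_smul_right] at h1
  simp only [Prod.snd_add, Prod.smul_snd, smul_eq_mul] at h1
  have h3 : 0 ≤ θ * (A + θ * B / 2) := by
    rw [hA, hB]; nlinarith
  have h4 : 0 ≤ A + θ * B / 2 := nonneg_of_mul_nonneg_right h3 hθ0
  nlinarith

variable {H : Type*} [NormedAddCommGroup H] [InnerProductSpace ℝ H]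

/-- A point monotonically related to the graph of a maximal monotone operator lies on it. -/
theorem IsMaximalMonotoneOp.mem_of_related {T : H → Set H} (hT : IsMaximalMonotoneOp T) {x y : H}
    (h : ∀ a b, b ∈ T a → 0 ≤ inner ℝ (x - a) (y - b)) : y ∈ T x := by
  have hmono : IsMonotoneOp fun a => T a ∪ {b | a = x ∧ b = y} := by
    rintro a a' b b' (hb | ⟨rfl, rfl⟩) (hb' | ⟨rfl, rfl⟩)
    · exact hT.1 _ _ _ _ hb hb'
    · have := h _ _ hb
      rwa [← inner_neg_neg, neg_sub, neg_sub] at this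
    · exact h _ _ hb'
    · simp
  have heq := congrFun (hT.2 _ hmono fun a => Set.subset_union_left) x
  rw [← heq]
  exact Or.inr ⟨rfl, rfl⟩

/-- Minty's theorem at the origin, for a monotone operator containing every pair monotonically
related to it. The minimiser `(x, y)` of the Fitzpatrick function plus half the squared norm
yields the pair `(-y, -x)`, which is related to the graph with a margin `‖x + y‖²`. -/
theorem exists_neg_mem [CompleteSpace H] {T : H → Set H} (hT : IsMonotoneOp T)
    (hmax : ∀ x y, (∀ a b, b ∈ T a → 0 ≤ inner ℝ (x - a) (y - b)) → y ∈ T x)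
    (hne : ∃ x, (T x).Nonempty) : ∃ x, -x ∈ T x := by
  -- the epigraph of the Fitzpatrick function of `T`
  set K : Set (WithLp 2 (H × H) × ℝ) :=
    {p | ∀ a b, b ∈ T a → inner ℝ p.1.fst b + inner ℝ a p.1.snd - inner ℝ a b ≤ p.2} with hKdef
  have hgraph : ∀ x y, y ∈ T x → (WithLp.toLp 2 (x, y), inner ℝ x y) ∈ K := by
    intro x y hy a b hb
    have := hT _ _ _ _ hy hb
    simp only [inner_sub_left, inner_sub_right] at this
    change inner ℝ x b + inner ℝ a y - inner ℝ a b ≤ inner ℝ x y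
    linarith
  have hlow : ∀ p ∈ K, inner ℝ p.1.fst p.1.snd ≤ p.2 := by
    intro p hp
    by_contra! h
    have hmem : p.1.snd ∈ T p.1.fst := by
      refine hmax _ _ fun a b hb => ?_
      have := hp a b hb
      simp only [inner_sub_left, inner_sub_right]
      linarith
    have := hp _ _ hmem
    linarith
  have hclosed : IsClosed K := by
    simp only [hKdef, Set.ofPred_forall]
    refine isClosed_iInter fun a => isClosed_iInter fun b => isClosed_iInter fun _ => ?_
    refine isClosed_le ?_ continuous_snd
    have h1 : Continuous fun p : WithLp 2 (H × H) × ℝ => p.1.fst :=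
      (WithLp.prod_continuous_ofLp 2 H H).fst.comp continuous_fst
    have h2 : Continuous fun p : WithLp 2 (H × H) × ℝ => p.1.snd :=
      (WithLp.prod_continuous_ofLp 2 H H).snd.comp continuous_fst
    fun_prop
  have hconv : Convex ℝ K := by
    intro p hp q hq s t hs ht hst a b hb
    have h1 := mul_le_mul_of_nonneg_left (hp a b hb) hs
    have h2 := mul_le_mul_of_nonneg_left (hq a b hb) ht
    simp only [Prod.fst_add, Prod.smul_fst, Prod.snd_add, Prod.smul_snd, smul_eq_mul,
      WithLp.add_fst, WithLp.add_snd, WithLp.smul_fst, WithLp.smul_snd, inner_add_left,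
      inner_add_right, real_inner_smul_left, real_inner_smul_right]
    have h3 : inner ℝ a b = s * inner ℝ a b + t * inner ℝ a b := by rw [← add_mul, hst, one_mul]
    linarith
  obtain ⟨x₀, y₀, hy₀⟩ := hne
  obtain ⟨p, hpK, hpmin⟩ := exists_minimizer_add_half_norm_sq hclosed hconv
    ⟨_, hgraph x₀ y₀ hy₀⟩ (by
      intro p hp
      have h1 := hlow p hp
      have h2 := norm_add_sq_real p.1.fst p.1.snd
      have h3 := sq_nonneg ‖p.1.fst + p.1.snd‖
      rw [WithLp.prod_norm_sq_eq_of_L2]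
      linarith)
  have hp := hlow p hpK
  set x := p.1.fst with hx
  set y := p.1.snd with hy
  have hrel : ∀ a b, b ∈ T a → ‖x + y‖ ^ 2 ≤ inner ℝ (-y - a) (-x - b) := by
    intro a b hb
    have h1 := sub_inner_le_of_minimizer hconv hpK hpmin (hgraph a b hb)
    rw [WithLp.prod_inner_apply] at h1
    simp only [WithLp.sub_fst, WithLp.sub_snd, WithLp.ofLp_fst, WithLp.ofLp_snd,
      inner_sub_right, real_inner_self_eq_norm_sq] at h1
    rw [← hx, ← hy, show (WithLp.toLp 2 (a, b)).fst = a from rfl,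
      show (WithLp.toLp 2 (a, b)).snd = b from rfl] at h1
    simp only [inner_sub_left, inner_sub_right, inner_neg_left, inner_neg_right]
    rw [norm_add_sq_real, real_inner_comm x y, real_inner_comm x a]
    linarith
  have hmem : -x ∈ T (-y) := hmax _ _ fun a b hb => (sq_nonneg _).trans (hrel a b hb)
  have h0 := hrel _ _ hmem
  rw [sub_self, inner_zero_left] at h0
  have h1 : x + y = 0 :=
    norm_eq_zero.1 (pow_eq_zero_iff two_ne_zero |>.1 (h0.antisymm (sq_nonneg _)))
  rw [← eq_neg_of_add_eq_zero_left h1] at hmem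
  exact ⟨x, hmem⟩

/-! ### The resolvent -/

/-- Minty's theorem: the resolvent of a maximal monotone operator is everywhere defined. -/
theorem resolventMap_spec [CompleteSpace H] {T : H → Set H} (hT : IsMaximalMonotoneOp T)
    (hne : ∃ x, (T x).Nonempty) {r : ℝ} (hr : 0 < r) (x : H) :
    r⁻¹ • (x - resolventMap T r x) ∈ T (resolventMap T r x) := by
  obtain ⟨y, hy⟩ : ∃ y, -y ∈ {b | r⁻¹ • (b + x) ∈ T y} := by
    refine exists_neg_mem (T := fun y => {b | r⁻¹ • (b + x) ∈ T y}) ?_ ?_ ?_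
    · intro a a' b b' hb hb'
      have := hT.1 _ _ _ _ hb hb'
      rw [← smul_sub, add_sub_add_right_eq_sub, real_inner_smul_right] at this
      exact nonneg_of_mul_nonneg_right this (inv_pos.2 hr)
    · intro a b h
      refine hT.mem_of_related fun a' b' hb' => ?_
      have h1 := h a' (r • b' - x) (by
        change r⁻¹ • (r • b' - x + x) ∈ T a'
        rwa [sub_add_cancel, inv_smul_smul₀ hr.ne'])
      have h2 : r⁻¹ • (b + x) - b' = r⁻¹ • (b - (r • b' - x)) := by
        rw [smul_sub, smul_sub, smul_add, inv_smul_smul₀ hr.ne']; abel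
      rw [h2, real_inner_smul_right]
      exact mul_nonneg (inv_nonneg.2 hr.le) h1
    · obtain ⟨a, b, hb⟩ := hne
      refine ⟨a, r • b - x, ?_⟩
      change r⁻¹ • (r • b - x + x) ∈ T a
      rwa [sub_add_cancel, inv_smul_smul₀ hr.ne']
  have hy' : r⁻¹ • (x - y) ∈ T y := by
    rw [sub_eq_neg_add]; exact hy
  rwa [resolventMap_eq hT.1 hr hy' (by rw [smul_inv_smul₀ hr.ne']; abel)]

theorem norm_resolventMap_sub_le [CompleteSpace H] {T : H → Set H} (hT : IsMaximalMonotoneOp T)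
    (hne : ∃ x, (T x).Nonempty) {r : ℝ} (hr : 0 < r) (x y : H) :
    ‖resolventMap T r x - resolventMap T r y‖ ≤ ‖x - y‖ := by
  have h := hT.1 _ _ _ _ (resolventMap_spec hT hne hr x) (resolventMap_spec hT hne hr y)
  set p := resolventMap T r x
  set q := resolventMap T r y
  rw [← smul_sub, real_inner_smul_right] at h
  have h1 := nonneg_of_mul_nonneg_right h (inv_pos.2 hr)
  rw [show x - p - (y - q) = (x - y) - (p - q) by abel, inner_sub_right,
    real_inner_self_eq_norm_sq] at h1
  have h2 := real_inner_le_norm (p - q) (x - y)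
  by_contra! h3
  nlinarith [norm_nonneg (p - q), norm_nonneg (x - y)]

theorem resolventMap_eq_self {T : H → Set H} (hT : IsMonotoneOp T) {r : ℝ} (hr : 0 < r) {s : H}
    (hs : s ∈ zeros T) : resolventMap T r s = s :=
  resolventMap_eq hT hr hs (by simp)

/-- For `r ≤ r'` the displacement `‖x - J_r x‖` is at most `‖x - J_r' x‖`, which in turn is at most
`r' / r` times `‖x - J_r x‖`. -/
theorem norm_resolventMap_sub_self_compare [CompleteSpace H] {T : H → Set H}
    (hT : IsMaximalMonotoneOp T) (hne : ∃ x, (T x).Nonempty) {r r' : ℝ} (hr : 0 < r)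
    (hrr' : r ≤ r') (x : H) :
    ‖resolventMap T r x - x‖ ≤ ‖resolventMap T r' x - x‖ ∧
      r * ‖resolventMap T r' x - x‖ ≤ r' * ‖resolventMap T r x - x‖ := by
  have hr' := hr.trans_le hrr'
  have h := hT.1 _ _ _ _ (resolventMap_spec hT hne hr x) (resolventMap_spec hT hne hr' x)
  rw [← norm_neg, neg_sub, ← norm_neg (resolventMap T r' x - x), neg_sub]
  set p := x - resolventMap T r x with hp
  set q := x - resolventMap T r' x with hq
  rw [show resolventMap T r x - resolventMap T r' x = q - p by rw [hp, hq]; abel] at h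
  have h1 : 0 ≤ inner ℝ (q - p) (r' • p - r • q) := by
    have h2 : r' • p - r • q = (r * r') • (r⁻¹ • p - r'⁻¹ • q) := by
      rw [smul_sub (r * r'), smul_smul, smul_smul, mul_inv_cancel_right₀ hr'.ne',
        mul_comm r r', mul_inv_cancel_right₀ hr.ne']
    rw [h2, real_inner_smul_right]
    exact mul_nonneg (by positivity) h
  simp only [inner_sub_left, inner_sub_right, real_inner_smul_right,
    real_inner_self_eq_norm_sq, real_inner_comm p q] at h1
  have h2 := real_inner_le_norm p q
  have h3 : (‖p‖ - ‖q‖) * (r' * ‖p‖ - r * ‖q‖) ≤ 0 := by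
    nlinarith
  have hp0 := norm_nonneg p
  have hq0 := norm_nonneg q
  constructor
  · by_contra! hlt
    have : r * ‖q‖ < r' * ‖p‖ := by nlinarith
    nlinarith [mul_pos (sub_pos.2 hlt) (sub_pos.2 this)]
  · by_contra! hlt
    have : ‖p‖ < ‖q‖ := by nlinarith
    nlinarith [mul_pos (sub_pos.2 hlt) (sub_pos.2 this)]

/-! ### Approximate fixed points and approximate projections -/

/-- Approximate fixed points of a nonexpansive map are approximately convex. -/
theorem norm_map_sub_self_sq_le_of_segment {F : H → H} (hF : ∀ x y, ‖F x - F y‖ ≤ ‖x - y‖)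
    {x y : H} {η d t : ℝ} (hx : ‖F x - x‖ ≤ η) (hy : ‖F y - y‖ ≤ η) (hd : ‖y - x‖ ≤ d)
    (ht0 : 0 ≤ t) (ht1 : t ≤ 1) :
    ‖F (x + t • (y - x)) - (x + t • (y - x))‖ ^ 2 ≤ d * η + η ^ 2 := by
  set p := x + t • (y - x) with hp
  have hη : 0 ≤ η := (norm_nonneg _).trans hx
  have h1 : ‖F p - x‖ ≤ t * ‖y - x‖ + η := by
    calc ‖F p - x‖ ≤ ‖F p - F x‖ + ‖F x - x‖ := norm_sub_le_norm_sub_add_norm_sub _ _ _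
      _ ≤ ‖p - x‖ + η := add_le_add (hF _ _) hx
      _ = t * ‖y - x‖ + η := by
        rw [hp, add_sub_cancel_left, norm_smul, Real.norm_of_nonneg ht0]
  have h2 : ‖F p - y‖ ≤ (1 - t) * ‖y - x‖ + η := by
    calc ‖F p - y‖ ≤ ‖F p - F y‖ + ‖F y - y‖ := norm_sub_le_norm_sub_add_norm_sub _ _ _
      _ ≤ ‖p - y‖ + η := add_le_add (hF _ _) hy
      _ = (1 - t) * ‖y - x‖ + η := by
        rw [show p - y = -((1 - t) • (y - x)) by rw [hp]; module, norm_neg, norm_smul,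
          Real.norm_of_nonneg (by linarith)]
  have h3 : ‖F p - p‖ ^ 2 =
      (1 - t) * ‖F p - x‖ ^ 2 + t * ‖F p - y‖ ^ 2 - t * (1 - t) * ‖y - x‖ ^ 2 := by
    rw [show F p - p = (F p - x) - t • (y - x) by rw [hp]; abel,
      show F p - y = (F p - x) - (y - x) by abel]
    rw [norm_sub_sq_real _ (t • (y - x)), norm_sub_sq_real _ (y - x), norm_smul,
      real_inner_smul_right, mul_pow, Real.norm_eq_abs, sq_abs]
    ring
  have h4 : ‖F p - x‖ ^ 2 ≤ (t * ‖y - x‖ + η) ^ 2 := pow_le_pow_left₀ (norm_nonneg _) h1 2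
  have h5 : ‖F p - y‖ ^ 2 ≤ ((1 - t) * ‖y - x‖ + η) ^ 2 := pow_le_pow_left₀ (norm_nonneg _) h2 2
  have h6 := mul_le_mul_of_nonneg_left h4 (by linarith : 0 ≤ 1 - t)
  have h7 := mul_le_mul_of_nonneg_left h5 ht0
  have h8 : ‖F p - p‖ ^ 2 ≤ 4 * (t * (1 - t)) * (‖y - x‖ * η) + η ^ 2 := by
    rw [h3]; nlinarith
  have h9 : 4 * (t * (1 - t)) ≤ 1 := by nlinarith [sq_nonneg (2 * t - 1)]
  have h10 : 4 * (t * (1 - t)) * (‖y - x‖ * η) ≤ 1 * (‖y - x‖ * η) :=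
    mul_le_mul_of_nonneg_right h9 (by positivity)
  have h11 : ‖y - x‖ * η ≤ d * η := mul_le_mul_of_nonneg_right hd hη
  linarith

/-- A nonnegative function bounded by `R ε` at a point of `A R` cannot decrease by more than `ε`
at each of `R` steps down `A R, …, A 0`. -/
theorem exists_almost_minimizer {α : Type*} (φ : α → ℝ) (hφ : ∀ x, 0 ≤ φ x) (A : ℕ → Set α)
    (ε : ℝ) (R : ℕ) (hR : 0 < R) (x₀ : α) (hx₀ : x₀ ∈ A R) (h : φ x₀ ≤ R * ε) :
    ∃ i < R, ∃ x ∈ A (i + 1), ∀ y ∈ A i, φ x ≤ φ y + ε := by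
  induction R generalizing x₀ with
  | zero => exact absurd hR (lt_irrefl 0)
  | succ R ih =>
    by_cases hc : ∀ y ∈ A R, φ x₀ ≤ φ y + ε
    · exact ⟨R, Nat.lt_succ_self R, x₀, hx₀, hc⟩
    · push Not at hc
      obtain ⟨y, hy, hlt⟩ := hc
      push_cast at h
      have hyR : φ y < R * ε := by linarith
      rcases Nat.eq_zero_or_pos R with rfl | hR'
      · have := hφ y
        simp only [Nat.cast_zero, zero_mul] at hyR
        linarith
      · obtain ⟨i, hi, hx⟩ := ih hR' y hy hyR.le
        exact ⟨i, hi.trans (Nat.lt_succ_self R), hx⟩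

/-- Variational inequality for a point that almost minimises the distance to `u` along a
segment of length at most `2 N`; the step `1 / (4 N² k)` balances the two error terms. -/
theorem inner_le_of_almost_minimizer {u x y : H} {N k : ℝ} (hN : 1 ≤ N) (hk : 1 ≤ k)
    (hd : ‖y - x‖ ≤ 2 * N)
    (h : ∀ t : ℝ, 0 ≤ t → t ≤ 1 →
      ‖u - x‖ ^ 2 ≤ ‖u - (x + t • (y - x))‖ ^ 2 + 1 / (4 * N ^ 2 * k ^ 2)) :
    inner ℝ (u - x) (y - x) ≤ 1 / k := by
  have hN0 : 0 < N := by linarith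
  have hk0 : 0 < k := by linarith
  set t := 1 / (4 * N ^ 2 * k) with ht
  have ht0 : 0 < t := by positivity
  have ht1 : t ≤ 1 := by
    rw [ht, div_le_one (by positivity)]
    nlinarith [one_le_pow₀ hN (n := 2), one_le_mul_of_one_le_of_one_le (one_le_pow₀ hN (n := 2)) hk]
  have h1 := h t ht0.le ht1
  rw [show u - (x + t • (y - x)) = (u - x) - t • (y - x) by abel, norm_sub_sq_real _ (t • (y - x)),
    norm_smul, real_inner_smul_right, mul_pow, Real.norm_eq_abs, sq_abs] at h1
  have h2 : ‖y - x‖ ^ 2 ≤ (2 * N) ^ 2 := pow_le_pow_left₀ (norm_nonneg _) hd 2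
  have h3 : t ^ 2 * ‖y - x‖ ^ 2 ≤ t / k := by
    calc t ^ 2 * ‖y - x‖ ^ 2 ≤ t ^ 2 * (2 * N) ^ 2 := mul_le_mul_of_nonneg_left h2 (sq_nonneg t)
      _ = t / k := by rw [ht]; field_simp; ring
  have h4 : 1 / (4 * N ^ 2 * k ^ 2) = t / k := by rw [ht]; field_simp
  rw [h4] at h1
  have h5 : t * inner ℝ (u - x) (y - x) ≤ t * (1 / k) := by
    rw [mul_one_div]; linarith
  exact le_of_mul_le_mul_left h5 ht0

/-! ### Monotonicity of the rates -/

theorem mu_mono {a N₂ N₃ : ℕ} {ℓ E : ℕ → ℕ} (hℓ : Monotone ℓ) (hE : Monotone E) :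
    Monotone (mu a N₂ N₃ ℓ E) := by
  intro k k' h
  unfold mu
  gcongr
  · exact hℓ (by gcongr)
  · exact hE (by gcongr)

theorem tildeFun_monotone (μ : ℕ → ℕ) {f : ℕ → ℕ} (hf : Monotone f) (k : ℕ) :
    Monotone (tildeFun μ f k) := by
  intro m m' h
  unfold tildeFun
  gcongr
  exact hf (by gcongr)

theorem xi_mono {χ : ℕ → (ℕ → ℕ) → ℕ} (hχ : MonotoneFunctional χ) {μ : ℕ → ℕ} (hμ : Monotone μ)
    (a : ℕ) {f : ℕ → ℕ} (hf : Monotone f) : Monotone fun k => xi χ μ a k f := by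
  intro k k' h
  have h2 : 2 * k + 1 ≤ 2 * k' + 1 := by omega
  refine max_le_max (hμ h2) (hχ _ _ _ (by gcongr) _ ?_).1
  refine fun n m hmn => ⟨?_, tildeFun_monotone μ hf _ hmn⟩
  exact add_le_add (hμ h2) (hf (max_le_max (hμ h2) hmn))

theorem le_check {N : ℕ} (hN : 0 < N) (g : ℕ → ℕ) (m : ℕ) : m ≤ check N g m := by
  refine le_trans ?_ (le_max_right _ _)
  nlinarith

theorem iterate_check_mono {N : ℕ} (hN : 0 < N) (g : ℕ → ℕ) (x : ℕ) :
    Monotone fun i => (check N g)^[i] x := by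
  refine monotone_nat_of_le_succ fun i => ?_
  simp only [Function.iterate_succ_apply']
  exact le_check hN g _

theorem thetaH_mono (k : ℕ) (G : ℕ → ℕ) (D : ℕ) : Monotone (thetaH k G D) := by
  intro m m' h
  unfold thetaH
  gcongr

theorem thetaG_mono (k : ℕ) {f L : ℕ → ℕ} (hf : Monotone f) (hL : Monotone L) (G : ℕ → ℕ) (D : ℕ) :
    Monotone (thetaG k f L G D) := by
  intro m m' h
  unfold thetaG
  gcongr
  exact hf (by gcongr; exact hL (thetaH_mono _ _ _ h))

theorem zeta_add_one {C : ℕ → ℕ} {c : ℕ} (hc : c ≠ 0) (k : ℕ) {n : ℕ} (hC : C n ≠ 0) :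
    zeta C c k n + 1 = C n * c * (k + 1) := by
  unfold zeta
  have : 0 < C n * c * (k + 1) := by positivity
  omega

theorem zeta_mono {C : ℕ → ℕ} (hC : Monotone C) (c N : ℕ) {f : ℕ → ℕ} (hf : Monotone f) :
    Monotone fun m => zeta C c ((1 + 4 * N) * (f m + 1) - 1) (f m) := by
  intro m m' h
  have h1 := hf h
  have h2 := hC h1
  unfold zeta
  dsimp only
  gcongr

/-! ### Asymptotic regularity and approximate projections of the anchor -/

/-- In the modified proximal point iteration, `z' = λ u + γ z + δ j + e = γ z + (1 - γ) w` gives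
`(1 - γ) (w - j) = λ (u - j) + e`, so that `w` and `j` are close. -/
theorem norm_sub_le_of_step {u z z' w j e : H} {lam γ δ a B : ℝ} (ha : 0 < a) (hlam : 0 ≤ lam)
    (hsum : lam + γ + δ = 1) (hγ : γ ≤ 1 - 1 / a) (hz : z' = lam • u + γ • z + δ • j + e)
    (hw : z' = γ • z + (1 - γ) • w) (hB : ‖u - j‖ ≤ B) :
    ‖j - z‖ ≤ ‖w - z‖ + a * (lam * B + ‖e‖) := by
  have h1 : (1 - γ) • (w - j) = lam • (u - j) + e := by
    have hδ : δ = 1 - γ - lam := by linarith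
    have h := hw.symm.trans hz
    rw [hδ] at h
    have h2 : (1 - γ) • w = lam • u + (1 - γ - lam) • j + e := by
      rw [← sub_eq_zero] at h ⊢
      rw [← h]; abel
    rw [smul_sub, h2]; module
  have h2 : (1 - γ) * ‖w - j‖ ≤ lam * B + ‖e‖ := by
    have h0 : 0 ≤ 1 - γ := by
      have : 0 < 1 / a := by positivity
      linarith
    calc (1 - γ) * ‖w - j‖ = ‖lam • (u - j) + e‖ := by
          rw [← h1, norm_smul, Real.norm_of_nonneg h0]
      _ ≤ lam * ‖u - j‖ + ‖e‖ := by
          refine (norm_add_le _ _).trans ?_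
          rw [norm_smul, Real.norm_of_nonneg hlam]
      _ ≤ lam * B + ‖e‖ := by gcongr
  have h3 : ‖w - j‖ ≤ a * (lam * B + ‖e‖) := by
    calc ‖w - j‖ = a * (1 / a * ‖w - j‖) := by field_simp
      _ ≤ a * ((1 - γ) * ‖w - j‖) := by
          gcongr; linarith
      _ ≤ _ := by gcongr
  have h4 : ‖j - z‖ ≤ ‖j - w‖ + ‖w - z‖ := norm_sub_le_norm_sub_add_norm_sub _ _ _
  rw [norm_sub_rev j w] at h4
  linarith

/-- If `j m` is close to `w m` for `λ_m` and `e m` small, a rate of metastability for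
`‖w m - z m‖ → 0` is turned into one for `‖j m - z m‖ → 0`. -/
theorem metaNull_xi {X : Type*} [NormedAddCommGroup X] {w z j e : ℕ → X}
    {lam : ℕ → ℝ} {a N₂ N₃ : ℕ} (ha : a ≠ 0) {ℓ E : ℕ → ℕ}
    (hℓ : ∀ k : ℕ, ∀ n ≥ ℓ k, lam n ≤ 1 / ((k : ℝ) + 1))
    (hE : ∀ k : ℕ, ∀ n ≥ E k + 1, ‖e n‖ ≤ 1 / ((k : ℝ) + 1))
    (hj : ∀ m, ‖j m - z m‖ ≤
      ‖w m - z m‖ + a * (lam m * (((N₂ + N₃) + N₃ : ℕ) : ℝ) + ‖e m‖))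
    {χ : ℕ → (ℕ → ℕ) → ℕ} (hχ : MetaNull w z χ) : MetaNull j z (xi χ (mu a N₂ N₃ ℓ E) a) := by
  intro k f hf
  set μ := mu a N₂ N₃ ℓ E with hμ
  obtain ⟨n', hn', h⟩ := hχ (4 * a * (k + 1)) (tildeFun μ f (2 * k + 1)) (tildeFun_monotone μ hf _)
  refine ⟨max (μ (2 * k + 1)) n', max_le_max le_rfl hn', fun m hm => ?_⟩
  obtain ⟨hm1, hm2⟩ := hm
  have hwm := h m ⟨(le_max_right _ _).trans hm1, by
    refine hm2.trans ?_
    unfold tildeFun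
    have : max (μ (2 * k + 1)) n' ≤ μ (2 * k + 1) + n' := by omega
    omega⟩
  have hμm : μ (2 * k + 1) ≤ m := (le_max_left _ _).trans hm1
  rw [hμ] at hμm
  unfold mu at hμm
  have hl := hℓ _ m ((le_max_left _ _).trans hμm)
  have he := hE _ m ((le_max_right _ _).trans hμm)
  set B := N₂ + N₃ + N₃ with hB
  have ha' : (0 : ℝ) < a := by positivity
  have hk : (0 : ℝ) < (k : ℝ) + 1 := by positivity
  push_cast at hwm hl he
  have h1 : lam m * (B : ℝ) ≤ 1 / (8 * a * (k + 1)) := by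
    calc lam m * (B : ℝ) ≤ 1 / (4 * a * (2 * k + 1 + 1) * B + 1) * B := by gcongr
      _ ≤ 1 / (8 * a * (k + 1)) := by
        rw [one_div_mul_eq_div, div_le_div_iff₀ (by positivity) (by positivity)]
        nlinarith
  have h2 : ‖e m‖ ≤ 1 / (8 * a * (k + 1)) :=
    he.trans (one_div_le_one_div_of_le (by positivity) (by nlinarith))
  have h3 : ‖w m - z m‖ ≤ 1 / (4 * (k + 1)) := by
    refine hwm.trans (one_div_le_one_div_of_le (by positivity) ?_)
    have : (1 : ℝ) ≤ a := by exact_mod_cast Nat.one_le_iff_ne_zero.2 ha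
    nlinarith
  calc ‖j m - z m‖ ≤ 1 / (4 * (k + 1)) + a * (1 / (8 * a * (k + 1)) + 1 / (8 * a * (k + 1))) := by
        refine (hj m).trans ?_
        gcongr
    _ = 1 / (2 * ((k : ℝ) + 1)) := by field_simp; norm_num
    _ ≤ 1 / ((k : ℝ) + 1) := one_div_le_one_div_of_le hk (by linarith)

/-- The quantitative content of the projection of `u` onto the fixed-point set of `F`: for a
sequence of approximate fixed points, an approximate fixed point `x` that satisfies the
variational inequality along a stretch of the sequence. -/
theorem exists_almost_projection {F : H → H} (hF : ∀ x y, ‖F x - F y‖ ≤ ‖x - y‖) {s u : H}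
    (hs : F s = s) {z : ℕ → H} {N : ℕ} (hN : 0 < N) (hz : ∀ m, ‖z m - s‖ ≤ N)
    (hu : 2 * ‖u - s‖ ≤ N) {ξ : ℕ → (ℕ → ℕ) → ℕ} (hξ : MetaNull (fun m => F (z m)) z ξ)
    (hmono : ∀ f, Monotone f → Monotone fun k => ξ k f) (k : ℕ) {f : ℕ → ℕ} (hf : Monotone f) :
    ∃ n ≤ psi ξ N k f, ∃ x, ‖x - s‖ ≤ N ∧ ‖F x - x‖ ≤ 1 / ((f n : ℝ) + 1) ∧
      ∀ m ∈ Set.Icc n (n + (f n + 1)), inner ℝ (u - x) (z m - x) ≤ 1 / ((k : ℝ) + 1) := by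
  have hN1 : (1 : ℝ) ≤ N := by exact_mod_cast hN
  -- one index more than `f n` will be needed, as the recursion involves `z (m + 1)`
  have hf1 : Monotone fun j => f j + 1 := fun _ _ h => Nat.add_le_add_right (hf h) 1
  set g : ℕ → ℕ := fun m => f (ξ m (fun j => f j + 1)) with hg
  set R := N ^ 4 * (k + 1) ^ 2 with hR
  have hR0 : 0 < R := by positivity
  set q : ℕ → ℕ := fun i => (check N g)^[i] 0 with hq
  -- `R` steps of size `ε = 1 / (4 N² (k + 1)²)` exhaust `(N / 2)² ≥ ‖u - s‖²`
  obtain ⟨i, hi, x, ⟨hxs, hx⟩, hmin⟩ := exists_almost_minimizer (fun x => ‖u - x‖ ^ 2)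
    (fun x => sq_nonneg _) (fun i => {x | ‖x - s‖ ≤ N ∧ ‖F x - x‖ ≤ 1 / ((q i : ℝ) + 1)})
    (1 / (4 * (N : ℝ) ^ 2 * ((k : ℝ) + 1) ^ 2)) R hR0 s
    ⟨by simp, by rw [hs, sub_self, norm_zero]; positivity⟩ (by
      have h1 : (R : ℝ) * (1 / (4 * (N : ℝ) ^ 2 * ((k : ℝ) + 1) ^ 2)) = (N / 2 : ℝ) ^ 2 := by
        rw [hR]; push_cast; field_simp; norm_num
      rw [h1]
      exact pow_le_pow_left₀ (norm_nonneg _) (by linarith) 2)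
  obtain ⟨n, hn, hzn⟩ := hξ (24 * N * (q i + 1) ^ 2) (fun j => f j + 1) hf1
  have hqsucc : q (i + 1) = check N g (q i) := by
    simp only [hq, Function.iterate_succ_apply']
  have hq1 : 24 * N * (q i + 1) ^ 2 ≤ q (i + 1) := hqsucc ▸ le_max_right _ _
  have hq2 : f n ≤ q (i + 1) := by
    rw [hqsucc]
    exact (hf hn).trans (le_max_left (g (24 * N * (q i + 1) ^ 2)) _)
  refine ⟨n, hn.trans ?_, x, hxs, hx.trans (Nat.one_div_le_one_div hq2), fun m hm => ?_⟩
  · refine hmono _ hf1 ?_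
    gcongr
    exact iterate_check_mono hN g 0 hi.le
  · set Q : ℝ := (q i : ℝ) + 1 with hQ
    have hQ1 : 1 ≤ Q := by rw [hQ]; linarith [Nat.cast_nonneg (α := ℝ) (q i)]
    set η : ℝ := 1 / (24 * N * Q ^ 2) with hη
    have hη0 : 0 < η := by positivity
    have hxη : ‖F x - x‖ ≤ η := by
      refine hx.trans (one_div_le_one_div_of_le (by positivity) ?_)
      have : ((24 * N * (q i + 1) ^ 2 : ℕ) : ℝ) ≤ q (i + 1) := by exact_mod_cast hq1
      push_cast at this
      rw [hQ]; linarith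
    have hzη : ‖F (z m) - z m‖ ≤ η := by
      refine (hzn m hm).trans (one_div_le_one_div_of_le (by positivity) ?_)
      push_cast
      rw [hQ]; linarith
    have hd : ‖z m - x‖ ≤ 2 * N := by
      have := norm_sub_le_norm_sub_add_norm_sub (z m) s x
      rw [norm_sub_rev s x] at this
      linarith [hz m]
    refine inner_le_of_almost_minimizer hN1 (by linarith [Nat.cast_nonneg (α := ℝ) k]) hd
      fun t ht0 ht1 => hmin _ ⟨?_, ?_⟩
    · have h1 : x + t • (z m - x) - s = (1 - t) • (x - s) + t • (z m - s) := by module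
      rw [h1]
      refine (norm_add_le _ _).trans ?_
      rw [norm_smul, norm_smul, Real.norm_of_nonneg ht0, Real.norm_of_nonneg (by linarith)]
      have h2 := mul_le_mul_of_nonneg_left hxs (by linarith : 0 ≤ 1 - t)
      have h3 := mul_le_mul_of_nonneg_left (hz m) ht0
      linarith
    · have h1 := norm_map_sub_self_sq_le_of_segment hF hxη hzη hd ht0 ht1
      refine le_of_sq_le_sq ?_ (by positivity)
      refine h1.trans ?_
      have h2 : 2 * N * η = 1 / (12 * Q ^ 2) := by rw [hη]; field_simp; norm_num
      have h3 : η ≤ 1 / (24 * Q ^ 2) :=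
        one_div_le_one_div_of_le (by positivity) (by nlinarith [sq_nonneg Q])
      have h4 : η ≤ 1 := h3.trans (by
        rw [div_le_one (by positivity)]; nlinarith)
      have h5 : η ^ 2 ≤ η := by nlinarith
      rw [h2]
      calc 1 / (12 * Q ^ 2) + η ^ 2 ≤ 1 / (12 * Q ^ 2) + 1 / (24 * Q ^ 2) := by linarith
        _ ≤ (1 / Q) ^ 2 := by
          have : (1 / Q) ^ 2 - (1 / (12 * Q ^ 2) + 1 / (24 * Q ^ 2)) = 7 / (8 * Q ^ 2) := by
            field_simp; norm_num
          have : 0 < 7 / (8 * Q ^ 2) := by positivity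
          linarith

/-- The point of `exists_almost_projection` for the resolvent of index `1 / c` is an approximate
fixed point of the resolvents of all indices `c_m`, `m ≤ f n`. -/
theorem exists_almost_common_projection [CompleteSpace H] {T : H → Set H}
    (hT : IsMaximalMonotoneOp T) {s u : H} (hs : s ∈ zeros T) {z : ℕ → H} {N : ℕ} (hN : 0 < N)
    (hz : ∀ m, ‖z m - s‖ ≤ N) (hu : 2 * ‖u - s‖ ≤ N) {cs : ℕ → ℝ} (hcs : ∀ n, 0 < cs n)
    {c : ℕ} (hc : c ≠ 0) (hcsc : ∀ n, 1 / (c : ℝ) ≤ cs n) {C : ℕ → ℕ} (hC : Monotone C)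
    (hcC : ∀ n, cs n ≤ (C n : ℝ)) {ξ : ℕ → (ℕ → ℕ) → ℕ}
    (hξ : MetaNull (fun m => resolventMap T (cs m) (z m)) z ξ)
    (hmono : ∀ f, Monotone f → Monotone fun k => ξ k f) (k : ℕ) {f : ℕ → ℕ} (hf : Monotone f) :
    ∃ n ≤ bigPsi (psi ξ N) C c N k f, ∃ x, ‖x - s‖ ≤ N ∧
      (∀ m ≤ f n, ‖resolventMap T (cs m) x - x‖ ≤ 1 / ((1 + 4 * N) * ((f n : ℝ) + 1))) ∧
      ∀ m ∈ Set.Icc n (f n), inner ℝ (u - x) (z (m + 1) - x) ≤ 1 / (2 * ((k : ℝ) + 1)) := by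
  have hne : ∃ x, (T x).Nonempty := ⟨s, 0, hs⟩
  have hc0 : (0 : ℝ) < c := by positivity
  have hr : (0 : ℝ) < 1 / c := by positivity
  have hCpos : ∀ n, 0 < C n := fun n => by exact_mod_cast (hcs n).trans_le (hcC n)
  have hξ' : MetaNull (fun m => resolventMap T (1 / c) (z m)) z ξ := by
    intro k f hf
    obtain ⟨n, hn, h⟩ := hξ k f hf
    exact ⟨n, hn, fun m hm =>
      (norm_resolventMap_sub_self_compare hT hne hr (hcsc m) (z m)).1.trans (h m hm)⟩
  obtain ⟨n, hn, x, hxs, hx, hin⟩ := exists_almost_projection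
    (norm_resolventMap_sub_le hT hne hr) (resolventMap_eq_self hT.1 hr hs) hN hz hu hξ' hmono
    (2 * k + 1) (zeta_mono hC c N hf)
  have hζ := zeta_add_one hc ((1 + 4 * N) * (f n + 1) - 1) (hCpos (f n)).ne'
  have hpos : 1 ≤ (1 + 4 * N) * (f n + 1) := Nat.mul_pos (by omega) (by omega)
  rw [Nat.sub_add_cancel hpos] at hζ
  refine ⟨n, hn, x, hxs, fun m hm => ?_, fun m hm => ?_⟩
  · have h1 := (norm_resolventMap_sub_self_compare hT hne hr (hcsc m) x).2
    have h2 : cs m ≤ C (f n) := (hcC m).trans (by exact_mod_cast hC hm)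
    have hC0 : (0 : ℝ) < C (f n) := by exact_mod_cast hCpos (f n)
    have h3 : ((zeta C c ((1 + 4 * N) * (f n + 1) - 1) (f n) : ℕ) : ℝ) + 1 =
        C (f n) * c * ((1 + 4 * N) * (f n + 1)) := by exact_mod_cast hζ
    rw [h3] at hx
    calc ‖resolventMap T (cs m) x - x‖ = c * (1 / c * ‖resolventMap T (cs m) x - x‖) := by
          field_simp
      _ ≤ c * (C (f n) * (1 / (C (f n) * c * ((1 + 4 * N) * (f n + 1))))) := by
          refine mul_le_mul_of_nonneg_left (h1.trans ?_) hc0.le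
          exact mul_le_mul h2 hx (norm_nonneg _) hC0.le
      _ = 1 / ((1 + 4 * N) * ((f n : ℝ) + 1)) := by field_simp
  · have hle : f n ≤ zeta C c ((1 + 4 * N) * (f n + 1) - 1) (f n) := by
      have h1 : 1 * 1 * (1 * (f n + 1)) ≤ C (f n) * c * ((1 + 4 * N) * (f n + 1)) := by
        gcongr
        · exact hCpos _
        · omega
        · omega
      omega
    have := hin (m + 1) ⟨by have := hm.1; omega, by have := hm.2; omega⟩
    refine this.trans (le_of_eq ?_)
    push_cast
    ring

/-! ### The recursive inequality -/

/-- The recursive inequality satisfied by `‖z m - x‖²` along the iteration. -/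
theorem norm_step_sub_sq_le {u z z' j e x : H} {lam γ δ v B : ℝ} (hlam : 0 ≤ lam) (hγ : 0 ≤ γ)
    (hδ : 0 ≤ δ) (hsum : lam + γ + δ = 1) (hz : z' = lam • u + γ • z + δ • j + e) (hv : 0 ≤ v)
    (hj : ‖j - x‖ ^ 2 ≤ ‖z - x‖ ^ 2 + v) (hB : 2 * ‖z' - x‖ ≤ B) :
    ‖z' - x‖ ^ 2 ≤ (1 - lam) * (‖z - x‖ ^ 2 + v) + lam * (2 * inner ℝ (u - x) (z' - x)) +
      B * ‖e‖ := by
  set p := γ • (z - x) + δ • (j - x) with hp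
  have h1 : z' - x = p + (lam • (u - x) + e) := by
    rw [hz, hp, show lam = 1 - γ - δ by linarith]; module
  -- convexity of the squared norm, with weights of total mass `1 - λ ≤ 1`
  have h2 : ‖p‖ ^ 2 ≤ (1 - lam) * (‖z - x‖ ^ 2 + v) := by
    have h3 : ‖p‖ ≤ γ * ‖z - x‖ + δ * ‖j - x‖ := by
      refine (norm_add_le _ _).trans ?_
      rw [norm_smul, norm_smul, Real.norm_of_nonneg hγ, Real.norm_of_nonneg hδ]
    have h4 := pow_le_pow_left₀ (norm_nonneg _) h3 2
    have h5 : (γ * ‖z - x‖ + δ * ‖j - x‖) ^ 2 ≤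
        (γ + δ) * (γ * ‖z - x‖ ^ 2 + δ * ‖j - x‖ ^ 2) := by
      nlinarith [mul_nonneg (mul_nonneg hγ hδ) (sq_nonneg (‖z - x‖ - ‖j - x‖))]
    have h6 : γ * ‖z - x‖ ^ 2 + δ * ‖j - x‖ ^ 2 ≤ (γ + δ) * (‖z - x‖ ^ 2 + v) := by
      nlinarith [mul_nonneg hγ hv]
    have h7 : (γ + δ) * ((γ + δ) * (‖z - x‖ ^ 2 + v)) ≤ (γ + δ) * (1 * (‖z - x‖ ^ 2 + v)) := by
      gcongr
      linarith
    have h8 := mul_le_mul_of_nonneg_left h6 (add_nonneg hγ hδ)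
    rw [show 1 - lam = γ + δ by linarith]
    linarith
  have h3 : ‖z' - x‖ ^ 2 ≤ ‖p‖ ^ 2 + 2 * inner ℝ (lam • (u - x) + e) (z' - x) := by
    have h4 : p = (z' - x) - (lam • (u - x) + e) := by rw [h1]; abel
    rw [h4, norm_sub_sq_real _ (lam • (u - x) + e), real_inner_comm]
    nlinarith [sq_nonneg ‖lam • (u - x) + e‖]
  rw [inner_add_left, real_inner_smul_left] at h3
  have h4 := real_inner_le_norm e (z' - x)
  have h5 := mul_le_mul_of_nonneg_left hB (norm_nonneg e)
  linarith

/-- Iterating the recursive inequality. -/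
theorem le_of_recurrence {s lam ε : ℕ → ℝ} {v r : ℝ} (hlam : ∀ m, lam m ∈ Set.Ioo (0 : ℝ) 1)
    (hε : ∀ m, 0 ≤ ε m) (hv : 0 ≤ v) (hr : 0 ≤ r) {n p : ℕ} (hnp : n ≤ p)
    (h : ∀ m, n ≤ m → m < p → s (m + 1) ≤ (1 - lam m) * (s m + v) + lam m * r + ε m) :
    s p ≤ (∏ i ∈ Finset.Ico n p, (1 - lam i)) * s n + p * v + r + ∑ i ∈ Finset.Ico n p, ε i := by
  induction p, hnp using Nat.le_induction with
  | base =>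
    rw [Finset.Ico_self, Finset.prod_empty, Finset.sum_empty, one_mul, add_zero]
    have : 0 ≤ (n : ℝ) * v := by positivity
    linarith
  | succ p hp ih =>
    have h1 := ih fun m hm hmp => h m hm (by omega)
    have h2 := h p hp (Nat.lt_succ_self p)
    obtain ⟨hl0, hl1⟩ := hlam p
    rw [Finset.prod_Ico_succ_top hp, Finset.sum_Ico_succ_top hp]
    set P := ∏ i ∈ Finset.Ico n p, (1 - lam i)
    set S := ∑ i ∈ Finset.Ico n p, ε i with hS
    have hS0 : 0 ≤ S := Finset.sum_nonneg fun i _ => hε i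
    have h3 := mul_le_mul_of_nonneg_left h1 (sub_nonneg.2 hl1.le)
    push_cast
    have h4 : 0 ≤ lam p * (p * v + v + S) := by positivity
    linarith

/-- The bound `Θ` for the recursive inequality: each of the four terms of `le_of_recurrence` is at
most `1 / (4 (k + 1))`. -/
theorem le_one_div_of_recurrence {s lam ε : ℕ → ℝ} (hlam : ∀ m, lam m ∈ Set.Ioo (0 : ℝ) 1)
    (hε : ∀ m, 0 ≤ ε m) {L : ℕ → ℕ}
    (hL : ∀ k : ℕ, (k : ℝ) ≤ ∑ i ∈ Finset.Icc 1 (L k), lam i) {k D : ℕ} (hD : 0 < D)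
    (hs : ∀ m, s m ≤ D) (f G : ℕ → ℕ)
    (hG : ∀ m p, G (4 * k + 3) + 1 ≤ m → ∑ i ∈ Finset.Ico m p, ε i ≤ 1 / (4 * ((k : ℝ) + 1)))
    {n : ℕ} (h : ∀ m ∈ Set.Icc n (thetaG k f L G D n), s (m + 1) ≤
      (1 - lam m) * (s m + 1 / ((thetaG k f L G D n : ℝ) + 1)) +
        lam m * (1 / (4 * ((k : ℝ) + 1))) + ε m) :
    ∀ p ∈ Set.Icc (L (thetaH k G D n) + 1) (f (L (thetaH k G D n) + 1)),
      s p ≤ 1 / ((k : ℝ) + 1) := by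
  rintro p ⟨hp1, hp2⟩
  set n₁ := max n (G (4 * k + 3) + 1) with hn₁
  set X := Real.log (4 * (D : ℝ) * ((k : ℝ) + 1)) with hX
  have hD1 : (1 : ℝ) ≤ D := by exact_mod_cast hD
  have hk0 : (0 : ℝ) ≤ k := Nat.cast_nonneg k
  have hH : thetaH k G D n = n₁ + ⌈X⌉₊ := rfl
  set M := L (thetaH k G D n) with hM
  have hLM := hL (thetaH k G D n)
  rw [← hM, hH] at hLM
  push_cast at hLM
  have hXc : X ≤ (⌈X⌉₊ : ℝ) := Nat.le_ceil X
  have hIcc : Finset.Icc 1 M = Finset.Ico 1 (M + 1) := by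
    ext i
    rw [Finset.mem_Icc, Finset.mem_Ico]
    omega
  rw [hIcc] at hLM
  have hcount : ∀ q, 1 ≤ q → ∑ i ∈ Finset.Ico 1 q, lam i ≤ q - 1 := by
    intro q hq
    refine (Finset.sum_le_sum fun i _ => (hlam i).2.le).trans (le_of_eq ?_)
    simp [Nat.cast_sub hq]
  have hn₁1 : 1 ≤ n₁ := le_trans (by omega) (le_max_right n (G (4 * k + 3) + 1))
  -- the terms `λ_i` are below `1`, so that a sum of at least `n₁` needs at least `n₁` terms
  have hn₁M : n₁ ≤ M + 1 := by
    have := hcount (M + 1) (by omega)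
    push_cast at this
    have h2 : (n₁ : ℝ) ≤ M := by linarith [Nat.cast_nonneg (α := ℝ) ⌈X⌉₊]
    have : n₁ ≤ M := by exact_mod_cast h2
    omega
  have hsumX : X ≤ ∑ i ∈ Finset.Ico n₁ p, lam i := by
    have h1 := Finset.sum_Ico_consecutive lam hn₁1 hn₁M
    have h2 := hcount n₁ hn₁1
    have h3 : ∑ i ∈ Finset.Ico n₁ (M + 1), lam i ≤ ∑ i ∈ Finset.Ico n₁ p, lam i :=
      Finset.sum_le_sum_of_subset_of_nonneg (Finset.Ico_subset_Ico_right hp1)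
        fun i _ _ => (hlam i).1.le
    linarith
  set g := thetaG k f L G D n with hg
  have hgval : g = 4 * (k + 1) * (f (M + 1) + 1) := rfl
  have hpg : p ≤ g := by
    rw [hgval]; nlinarith
  have hrec := le_of_recurrence (s := s) (ε := ε) (v := 1 / ((g : ℝ) + 1))
    (r := 1 / (4 * ((k : ℝ) + 1))) hlam hε (by positivity) (by positivity) (hn₁M.trans hp1)
    fun m hm hmp => h m ⟨(le_max_left _ _).trans hm, by omega⟩
  have hprod0 : 0 ≤ ∏ i ∈ Finset.Ico n₁ p, (1 - lam i) :=
    Finset.prod_nonneg fun i _ => sub_nonneg.2 (hlam i).2.le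
  have hprod : ∏ i ∈ Finset.Ico n₁ p, (1 - lam i) ≤ 1 / (4 * D * (k + 1)) := by
    calc ∏ i ∈ Finset.Ico n₁ p, (1 - lam i) ≤ ∏ i ∈ Finset.Ico n₁ p, Real.exp (-lam i) :=
          Finset.prod_le_prod (fun i _ => sub_nonneg.2 (hlam i).2.le)
            fun i _ => Real.one_sub_le_exp_neg _
      _ = Real.exp (-∑ i ∈ Finset.Ico n₁ p, lam i) := by
          rw [← Real.exp_sum, Finset.sum_neg_distrib]
      _ ≤ Real.exp (-X) := Real.exp_le_exp.2 (neg_le_neg hsumX)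
      _ = 1 / (4 * D * (k + 1)) := by
          rw [Real.exp_neg, hX, Real.exp_log (by positivity), one_div]
  have t1 : (∏ i ∈ Finset.Ico n₁ p, (1 - lam i)) * s n₁ ≤ 1 / (4 * ((k : ℝ) + 1)) := by
    calc (∏ i ∈ Finset.Ico n₁ p, (1 - lam i)) * s n₁
        ≤ (∏ i ∈ Finset.Ico n₁ p, (1 - lam i)) * D := mul_le_mul_of_nonneg_left (hs _) hprod0
      _ ≤ 1 / (4 * D * (k + 1)) * D := by gcongr
      _ = 1 / (4 * ((k : ℝ) + 1)) := by field_simp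
  have t2 : (p : ℝ) * (1 / ((g : ℝ) + 1)) ≤ 1 / (4 * ((k : ℝ) + 1)) := by
    rw [mul_one_div, div_le_div_iff₀ (by positivity) (by positivity), one_mul]
    have : p * (4 * (k + 1)) ≤ g + 1 := by rw [hgval]; nlinarith
    exact_mod_cast this
  have t3 := hG n₁ p (le_max_right _ _)
  have t4 : 1 / ((k : ℝ) + 1) = 4 * (1 / (4 * ((k : ℝ) + 1))) := by field_simp
  linarith

/-! ### Estimates along the iteration -/

theorem norm_iterate_sub_le {u s : H} {z j e : ℕ → H} {lam γ δ : ℕ → ℝ} {B : ℝ}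
    (hlam : ∀ n, 0 ≤ lam n) (hγ : ∀ n, 0 ≤ γ n) (hδ : ∀ n, 0 ≤ δ n)
    (hsum : ∀ n, lam n + γ n + δ n = 1)
    (hz : ∀ n, z (n + 1) = lam n • u + γ n • z n + δ n • j n + e n)
    (hj : ∀ n, ‖j n - s‖ ≤ ‖z n - s‖) (hu : ‖u - s‖ ≤ B) (hz0 : ‖z 0 - s‖ ≤ B) (n : ℕ) :
    ‖z n - s‖ ≤ B + ∑ i ∈ Finset.range n, ‖e i‖ := by
  induction n with
  | zero => simpa using hz0
  | succ n ih =>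
    rw [Finset.sum_range_succ]
    set S := ∑ i ∈ Finset.range n, ‖e i‖
    have hS : 0 ≤ S := Finset.sum_nonneg fun i _ => norm_nonneg _
    have h1 : z (n + 1) - s = lam n • (u - s) + γ n • (z n - s) + δ n • (j n - s) + e n := by
      rw [hz, show lam n = 1 - γ n - δ n by linarith [hsum n]]; module
    have h2 : ‖z (n + 1) - s‖ ≤
        lam n * ‖u - s‖ + γ n * ‖z n - s‖ + δ n * ‖j n - s‖ + ‖e n‖ := by
      rw [h1]
      refine (norm_add_le _ _).trans (add_le_add_left ((norm_add₃_le).trans ?_) _)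
      rw [norm_smul, norm_smul, norm_smul, Real.norm_of_nonneg (hlam n),
        Real.norm_of_nonneg (hγ n), Real.norm_of_nonneg (hδ n)]
    have h3 := mul_le_mul_of_nonneg_left (hu.trans (le_add_of_nonneg_right hS)) (hlam n)
    have h4 := mul_le_mul_of_nonneg_left ih (hγ n)
    have h5 := mul_le_mul_of_nonneg_left ((hj n).trans ih) (hδ n)
    have h6 : lam n * (B + S) + γ n * (B + S) + δ n * (B + S) = B + S := by
      rw [← add_mul, ← add_mul, hsum, one_mul]
    linarith

theorem sum_Ico_norm_le {X : Type*} [NormedAddCommGroup X] {e : ℕ → X} {E : ℕ → ℕ}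
    (hE : ∀ k n : ℕ, ∑ i ∈ Finset.Icc (E k + 1) (E k + n), ‖e i‖ ≤ 1 / ((k : ℝ) + 1))
    (k : ℕ) {m : ℕ} (hm : E k + 1 ≤ m) (p : ℕ) :
    ∑ i ∈ Finset.Ico m p, ‖e i‖ ≤ 1 / ((k : ℝ) + 1) := by
  refine (Finset.sum_le_sum_of_subset_of_nonneg ?_ fun i _ _ => norm_nonneg _).trans (hE k p)
  intro i hi
  rw [Finset.mem_Ico] at hi
  rw [Finset.mem_Icc]
  omega

/-- Along the iteration, `‖z m - x‖²` satisfies the recursive inequality for every `x` near the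
anchor zero `s` that is nearly fixed by the resolvent used in the step. -/
theorem norm_resolvent_step_sub_sq_le [CompleteSpace H] {T : H → Set H}
    (hT : IsMaximalMonotoneOp T) {s u z z' e x : H} (hs : s ∈ zeros T) {lam γ δ r q b N : ℝ}
    (hr : 0 < r) (hlam : 0 ≤ lam) (hγ : 0 ≤ γ) (hδ : 0 ≤ δ) (hsum : lam + γ + δ = 1)
    (hz : z' = lam • u + γ • z + δ • resolventMap T r z + e) (hN : 1 ≤ N) (hq : 1 ≤ q)
    (hzs : ‖z - s‖ ≤ N) (hzs' : ‖z' - s‖ ≤ N) (hxs : ‖x - s‖ ≤ N)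
    (hx : ‖resolventMap T r x - x‖ ≤ 1 / ((1 + 4 * N) * q))
    (hin : inner ℝ (u - x) (z' - x) ≤ b / 2) :
    ‖z' - x‖ ^ 2 ≤ (1 - lam) * (‖z - x‖ ^ 2 + 1 / q) + lam * b + 4 * N * ‖e‖ := by
  have hd : ∀ y, ‖y - s‖ ≤ N → ‖y - x‖ ≤ 2 * N := by
    intro y hy
    have := norm_sub_le_norm_sub_add_norm_sub y s x
    rw [norm_sub_rev s x] at this
    linarith
  set η := 1 / ((1 + 4 * N) * q) with hη
  have hη0 : 0 ≤ η := by positivity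
  have hη1 : η ≤ 1 := by
    rw [hη, div_le_one (by positivity)]
    nlinarith
  have hηq : (1 + 4 * N) * η = 1 / q := by rw [hη]; field_simp
  have hj : ‖resolventMap T r z - x‖ ^ 2 ≤ ‖z - x‖ ^ 2 + 1 / q := by
    have h1 : ‖resolventMap T r z - x‖ ≤ ‖z - x‖ + η :=
      (norm_sub_le_norm_sub_add_norm_sub _ (resolventMap T r x) _).trans
        (add_le_add (norm_resolventMap_sub_le hT ⟨s, 0, hs⟩ hr z x) hx)
    have h2 := pow_le_pow_left₀ (norm_nonneg _) h1 2
    have h3 := mul_le_mul_of_nonneg_right (hd z hzs) hη0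
    have h4 : η ^ 2 ≤ η := by nlinarith
    linarith
  have h1 := norm_step_sub_sq_le (x := x) (B := 4 * N) hlam hγ hδ hsum hz (by positivity) hj
    (by linarith [hd z' hzs'])
  have h2 := mul_le_mul_of_nonneg_left hin hlam
  linarith

end MPPA

theorem theorem4p5 {H : Type*} [NormedAddCommGroup H] [InnerProductSpace ℝ H] [CompleteSpace H]
    (T : H → Set H) (hT : MPPA.IsMaximalMonotoneOp T)
    (u : H) (z e : ℕ → H) (lam γ δ cs : ℕ → ℝ)
    (hcs : ∀ n, 0 < cs n)
    (hlam : ∀ n, lam n ∈ Set.Ioo (0 : ℝ) 1) (hγ : ∀ n, γ n ∈ Set.Ioo (0 : ℝ) 1)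
    (hδ : ∀ n, δ n ∈ Set.Ioo (0 : ℝ) 1) (hsum : ∀ n, lam n + γ n + δ n = 1)
    (hz : ∀ n, z (n + 1) =
      lam n • u + γ n • z n + δ n • MPPA.resolventMap T (cs n) (z n) + e n)
    (a c : ℕ) (ha : a ≠ 0) (hc : c ≠ 0)
    (ℓ L E : ℕ → ℕ) (hℓ : Monotone ℓ) (hL : Monotone L) (hE : Monotone E)
    (hQ₁ : ∀ k : ℕ, ∀ n ≥ ℓ k, lam n ≤ 1 / ((k : ℝ) + 1))
    (hQ₂ : ∀ k : ℕ, (k : ℝ) ≤ ∑ i ∈ Finset.Icc 1 (L k), lam i)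
    (hQ₃ : ∀ m : ℕ, 1 / (a : ℝ) ≤ γ m ∧ γ m ≤ 1 - 1 / (a : ℝ))
    (hQ₄ : ∀ n : ℕ, 1 / (c : ℝ) ≤ cs n)
    (hQ₆ : ∀ k n : ℕ, ∑ i ∈ Finset.Icc (E k + 1) (E k + n), ‖e i‖ ≤ 1 / ((k : ℝ) + 1))
    (C : ℕ → ℕ) (hC : Monotone C) (hcC : ∀ n, cs n ≤ (C n : ℝ))
    (N₂ N₃ : ℕ)
    (hN₂ : ∑ i ∈ Finset.range (E 0 + 1), ‖e i‖ + 1 ≤ (N₂ : ℝ))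
    (hN₃ : ∃ s ∈ MPPA.zeros T, max ‖u - s‖ ‖z 0 - s‖ ≤ (N₃ : ℝ))
    (w : ℕ → H) (hw : ∀ n, z (n + 1) = γ n • z n + (1 - γ n) • w n)
    (χ : ℕ → (ℕ → ℕ) → ℕ) (hχ : MPPA.MonotoneFunctional χ) (hQS : MPPA.MetaNull w z χ) :
    ∀ (k : ℕ) (f : ℕ → ℕ), Monotone f →
      ∃ n ≤ MPPA.phi χ a c N₂ N₃ ℓ L E C k f,
        ∀ i ∈ Set.Icc n (n + f n), ∀ j ∈ Set.Icc n (n + f n),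
          ‖z i - z j‖ ≤ 1 / ((k : ℝ) + 1) := by
  intro k f hf
  obtain ⟨s, hs, hmax⟩ := hN₃
  obtain ⟨hus, hz0s⟩ := max_le_iff.1 hmax
  have hne : ∃ x, (T x).Nonempty := ⟨s, 0, hs⟩
  have hl0 : ∀ n, 0 ≤ lam n := fun n => (hlam n).1.le
  have hγ0 : ∀ n, 0 ≤ γ n := fun n => (hγ n).1.le
  have hδ0 : ∀ n, 0 ≤ δ n := fun n => (hδ n).1.le
  have htail := fun k {m} hm p => MPPA.sum_Ico_norm_le hQ₆ k (m := m) hm p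
  have hJs : ∀ n, ‖MPPA.resolventMap T (cs n) (z n) - s‖ ≤ ‖z n - s‖ := fun n => by
    have := MPPA.norm_resolventMap_sub_le hT hne (hcs n) (z n) s
    rwa [MPPA.resolventMap_eq_self hT.1 (hcs n) hs] at this
  have hzs : ∀ n, ‖z n - s‖ ≤ N₂ + N₃ := by
    intro n
    have h1 := MPPA.norm_iterate_sub_le hl0 hγ0 hδ0 hsum hz hJs hus hz0s n
    have h2 : ∑ i ∈ Finset.range n, ‖e i‖ ≤ ∑ i ∈ Finset.range (E 0 + 1 + n), ‖e i‖ :=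
      Finset.sum_le_sum_of_subset_of_nonneg (Finset.range_mono (by omega))
        fun i _ _ => norm_nonneg _
    have h3 := htail 0 le_rfl (E 0 + 1 + n)
    have h4 := Finset.sum_range_add_sum_Ico (fun i => ‖e i‖) (Nat.le_add_right (E 0 + 1) n)
    norm_num at h3
    linarith
  set N := MPPA.boundN N₂ N₃ with hNdef
  have hN2N : N₂ + N₃ ≤ N := le_max_right _ _
  have hN3N : 2 * N₃ ≤ N := le_max_left _ _
  have hN₂1 : 1 ≤ N₂ := by
    have h : (0 : ℝ) ≤ ∑ i ∈ Finset.range (E 0 + 1), ‖e i‖ :=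
      Finset.sum_nonneg fun i _ => norm_nonneg _
    have : (1 : ℝ) ≤ N₂ := by linarith
    exact_mod_cast this
  have hN0 : 0 < N := by omega
  have hN1 : (1 : ℝ) ≤ N := by exact_mod_cast hN0
  have hzN : ∀ n, ‖z n - s‖ ≤ N := fun n => (hzs n).trans (by exact_mod_cast hN2N)
  have huN : 2 * ‖u - s‖ ≤ N := by
    have : (2 : ℝ) * N₃ ≤ N := by exact_mod_cast hN3N
    linarith
  have hξ := MPPA.metaNull_xi (j := fun m => MPPA.resolventMap T (cs m) (z m)) (e := e)
    (N₂ := N₂) (N₃ := N₃) ha hQ₁ (E := E)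
    (fun k n hn => by simpa using htail k hn (n + 1))
    (fun m => MPPA.norm_sub_le_of_step (by positivity) (hl0 m) (hsum m) (hQ₃ m).2 (hz m) (hw m) (by
      have h1 := norm_sub_le_norm_sub_add_norm_sub u s (MPPA.resolventMap T (cs m) (z m))
      rw [norm_sub_rev s] at h1
      push_cast
      linarith [hJs m, hzs m])) hQS
  have hmono : ∀ f, Monotone f → Monotone fun k => MPPA.xi χ (MPPA.mu a N₂ N₃ ℓ E) a k f :=
    fun f hf => MPPA.xi_mono hχ (MPPA.mu_mono hℓ hE) a hf
  set K := 4 * (k + 1) ^ 2 - 1 with hK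
  have hK1 : (K : ℝ) + 1 = 4 * ((k : ℝ) + 1) ^ 2 := by
    have h1 : 0 < 4 * (k + 1) ^ 2 := by positivity
    have : K + 1 = 4 * (k + 1) ^ 2 := by omega
    exact_mod_cast this
  set F : ℕ → ℕ := fun m => m + f m with hF
  set G : ℕ → ℕ := fun j => E (MPPA.boundM₂ N₂ N₃ * (j + 1)) with hG
  have hFmono : Monotone F := fun m n h => add_le_add h (hf h)
  obtain ⟨n, hn, x, hxs, hx, hin⟩ := MPPA.exists_almost_common_projection hT hs hN0 hzN huN hcs hc
    hQ₄ hC hcC hξ hmono (4 * K + 3) (MPPA.thetaG_mono K hFmono hL G (4 * N ^ 2))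
  have hM₂ : (4 * N : ℝ) ≤ MPPA.boundM₂ N₂ N₃ := by
    have : 4 * N ≤ MPPA.boundM₂ N₂ N₃ := by
      unfold MPPA.boundM₂ MPPA.boundM₁
      omega
    exact_mod_cast this
  have hbound := MPPA.le_one_div_of_recurrence (s := fun m => ‖z m - x‖ ^ 2)
    (ε := fun m => 4 * N * ‖e m‖) hlam (fun m => by positivity) hQ₂ (k := K) (D := 4 * N ^ 2)
    (by positivity) (fun m => by
      have h1 := norm_sub_le_norm_sub_add_norm_sub (z m) s x
      rw [norm_sub_rev s x] at h1
      have h2 := pow_le_pow_left₀ (norm_nonneg _) (show ‖z m - x‖ ≤ 2 * N by linarith [hzN m]) 2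
      push_cast
      linarith) F G
    (fun m p hm => by
      rw [← Finset.mul_sum]
      calc 4 * (N : ℝ) * ∑ i ∈ Finset.Ico m p, ‖e i‖
          ≤ 4 * N * (1 / ((MPPA.boundM₂ N₂ N₃ * (4 * K + 3 + 1) : ℕ) + 1)) :=
            mul_le_mul_of_nonneg_left (htail _ hm p) (by positivity)
        _ ≤ 1 / (4 * ((K : ℝ) + 1)) := by
            rw [mul_one_div, div_le_div_iff₀ (by positivity) (by positivity)]
            push_cast
            have hK0 : (0 : ℝ) ≤ 4 * (K + 1) := by positivity
            linarith [mul_le_mul_of_nonneg_right hM₂ hK0])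
    (n := n)
    (fun m hm => MPPA.norm_resolvent_step_sub_sq_le hT hs (hcs m) (hl0 m) (hγ0 m) (hδ0 m) (hsum m)
      (hz m) hN1 (by linarith [Nat.cast_nonneg (α := ℝ) (MPPA.thetaG K F L G (4 * N ^ 2) n)])
      (hzN m) (hzN (m + 1)) hxs (hx m hm.2) ((hin m hm).trans (le_of_eq (by
        push_cast
        field_simp
        ring))))
  -- `Theta` with a constant functional is the index reached from `n` itself
  refine ⟨MPPA.Theta K F L (fun _ _ => n) G (4 * N ^ 2), ?_, fun i hi j hj => ?_⟩
  · exact Nat.add_le_add_right (hL (MPPA.thetaH_mono _ _ _ hn)) 1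
  · have hhalf : ∀ i ∈ Set.Icc (MPPA.Theta K F L (fun _ _ => n) G (4 * N ^ 2))
        (F (MPPA.Theta K F L (fun _ _ => n) G (4 * N ^ 2))),
        ‖z i - x‖ ≤ 1 / (2 * ((k : ℝ) + 1)) := by
      intro i hi
      refine le_of_sq_le_sq ((hbound i hi).trans (le_of_eq ?_)) (by positivity)
      rw [hK1]
      field_simp
      norm_num
    have h1 := norm_sub_le_norm_sub_add_norm_sub (z i) x (z j)
    rw [norm_sub_rev x (z j)] at h1
    have h2 : 1 / ((k : ℝ) + 1) = 1 / (2 * ((k : ℝ) + 1)) + 1 / (2 * ((k : ℝ) + 1)) := by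
      field_simp
      norm_num
    linarith [hhalf i hi, hhalf j hj]
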